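/- Let $\beta\mathbb N$ be the Stone–Čech compactification of the discrete space $\mathbb N$, and let $C_p(\beta\mathbb N)$ be the space of continuous real-valued functions on $\beta\mathbb N$ with the topology of pointwise convergence. Let $\ell_\infty=\{x\in\mathbb R^{\mathbb N}:\sup_n|x_n|<\infty\}$ and $c_0=\{x\in\mathbb R^{\mathbb N}: x_n\to 0\}$, both endowed with the subspace topology inherited from the product topology of $\mathbb R^{\mathbb N}$ (not with the norm topology). A quotient of a topological vector space $E$ is a space $E/Z$ with the quotient topology, where $Z$ is a closed linear subspace of $E$; isomorphic means linearly homeomorphic; a linear subspace $S$ of $E$ is complemented if there is a continuous linear projection of $E$ onto $S$. A locally convex space is Polishable if it admits a finer locally convex vector topology that is separable, metrizable and complete (a separable Fréchet topology). Then the space $C_p(\beta\mathbb N)$ 1. has a quotient isomorphic to $\ell_\infty$; 2. contains a linear subspace isomorphic to $c_0$; 3. has no quotient isomorphic to $c_0$; 4. has no infinite-dimensional Polishable quotient; 5. contains no complemented separable infinite-dimensional linear subspace. -/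

import Mathlib

open Filter Topology

/-- `C_p(X)`: the vector space of continuous real-valued functions on `X`. As a subspace of the
product `ℝ^X = (X → ℝ)` its type carries the topology of pointwise convergence. -/
abbrev Cp (X : Type*) [TopologicalSpace X] : Submodule ℝ (X → ℝ) :=
  continuousSubmodule X ℝ ℝ

/-- The space of bounded real sequences, as a subspace of `ℝ^ℕ` with the product topology
(not with the supremum norm). -/
def ellInfty : Submodule ℝ (ℕ → ℝ) where
  carrier := {x | ∃ C : ℝ, ∀ n, |x n| ≤ C}
  add_mem' := by
    rintro x y ⟨C, hC⟩ ⟨D, hD⟩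
    exact ⟨C + D, fun n => (abs_add_le _ _).trans (add_le_add (hC n) (hD n))⟩
  zero_mem' := ⟨0, fun n => by simp⟩
  smul_mem' := by
    rintro c x ⟨C, hC⟩
    refine ⟨|c| * C, fun n => ?_⟩
    simpa [abs_mul] using mul_le_mul_of_nonneg_left (hC n) (abs_nonneg c)

/-- The space of real sequences converging to zero, as a subspace of `ℝ^ℕ` with the product
topology (not with the supremum norm). -/
def cZero : Submodule ℝ (ℕ → ℝ) where
  carrier := {x | Tendsto x atTop (𝓝 0)}
  add_mem' {x y} hx hy := by
    have h : Tendsto (fun n => x n + y n) atTop (𝓝 (0 + 0)) := Tendsto.add hx hy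
    rwa [add_zero] at h
  zero_mem' := tendsto_const_nhds
  smul_mem' c x hx := by
    have h : Tendsto (fun n => c * x n) atTop (𝓝 (c * 0)) := Tendsto.const_mul c hx
    rwa [mul_zero] at h

/-- A real topological vector space `E` is *Polishable* if it admits a stronger (i.e. finer)
separable Fréchet topology: a locally convex vector space topology which is metrizable, complete
and separable. The uniform structure below is the one that the vector space topology induces
(this is `IsUniformAddGroup`), so `CompleteSpace` is completeness as a topological vector space.
Recall that `t₁ ≤ t₂` in Mathlib means that `t₁` is finer than `t₂`. -/
def IsPolishable (E : Type*) [AddCommGroup E] [Module ℝ E] [τ : TopologicalSpace E] : Prop :=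
  ∃ u : UniformSpace E,
    u.toTopologicalSpace ≤ τ ∧
    @IsUniformAddGroup E u _ ∧
    @ContinuousSMul ℝ E _ _ u.toTopologicalSpace ∧
    @LocallyConvexSpace ℝ E _ _ _ _ u.toTopologicalSpace ∧
    @TopologicalSpace.MetrizableSpace E u.toTopologicalSpace ∧
    @CompleteSpace E u ∧
    @TopologicalSpace.SeparableSpace E u.toTopologicalSpace

/-!
A compact extremally disconnected space is projective (Gleason), so continuous functions with
prescribed values on disjoint open sets exist as soon as the constraints are closed and pointwise
satisfiable. Given finitely supported measures of norm one with disjoint supports, most of the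
mass of infinitely many of them can be separated by clopen sets; a function taking the signs of
their weights there shows that they do not tend to zero weak*.

Suppose that a separable barrelled space maps continuously onto an infinite-dimensional quotient of
`C_p(X)` by a closed subspace `Z`. The annihilator of `Z` is infinite-dimensional, so it contains
norm-one measures with disjoint supports, the `n`-th of which vanishes on the images of the first
`n` elements of a dense sequence. By Banach–Steinhaus they tend to zero weak*, a contradiction.
This rules out infinite-dimensional Polishable quotients, quotients isomorphic to `c_0` (an image
of the Banach space `C(ℕ ∪ {∞})`), and infinite-dimensional complemented separable subspaces `S`
(the functions in `S` factor through a single metrizable compact `K`, and `C(K)` is separable).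

The space `c_0` embeds into `C_p(X)` through a map from `X` to `ℕ ∪ {∞}` whose range contains `ℕ`.
The quotient `ℓ_∞` is obtained from `f ↦ (∑ i ≤ n, 2⁻ⁱ f(x n i))ₙ` for a suitable discrete double
sequence `x`: a finite set of points misses the closure of some column `j`, which therefore can
absorb all but finitely many of the prescribed values, so this map is open.
-/

open Set Function

section Extension

variable {X : Type*} [TopologicalSpace X] [T2Space X] [ExtremallyDisconnected X]

theorem exists_pairwiseDisjoint_isClopen {ι : Type*} {s : Set ι} (hs : s.Finite)
    {F : ι → Set X} (hF : ∀ i ∈ s, (F i).Finite) (hdisj : s.PairwiseDisjoint F) :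
    ∃ V : ι → Set X, (∀ i, IsClopen (V i)) ∧ (∀ i ∈ s, F i ⊆ V i) ∧ s.PairwiseDisjoint V := by
  obtain ⟨U, hU, hUdisj⟩ := (hs.biUnion hF).t2_separation
  have hopen (i : ι) : IsOpen (⋃ x ∈ F i, U x) := isOpen_biUnion fun x _ => (hU x).2
  refine ⟨fun i => closure (⋃ x ∈ F i, U x),
    fun i => ⟨isClosed_closure, ExtremallyDisconnected.open_closure _ (hopen i)⟩,
    fun i _ x hx => subset_closure (mem_biUnion hx (hU x).1), fun i hi j hj hij => ?_⟩
  refine ExtremallyDisconnected.disjoint_closure_of_disjoint_isOpen ?_ (hopen i) (hopen j)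
  simp only [disjoint_iUnion_left, disjoint_iUnion_right]
  intro x hx z hz
  exact hUdisj (mem_biUnion hi hz) (mem_biUnion hj hx)
    fun h => disjoint_left.1 (hdisj hi hj hij) hz (h ▸ hx)

variable [CompactSpace X]

theorem exists_continuous_selection {E : Set (X × ℝ)} (hE : IsCompact E)
    (hne : ∀ x, ∃ t, (x, t) ∈ E) : ∃ f : Cp X, ∀ x, (x, f.1 x) ∈ E := by
  have : CompactSpace E := isCompact_iff_compactSpace.1 hE
  have hfst : Continuous fun p : E => p.1.1 := continuous_fst.comp continuous_subtype_val
  have hsurj : Surjective fun p : E => p.1.1 :=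
    fun x => (hne x).elim fun t ht => ⟨⟨(x, t), ht⟩, rfl⟩
  obtain ⟨h, hh, hlift⟩ := CompactT2.ExtremallyDisconnected.projective continuous_id hfst hsurj
  refine ⟨⟨fun x => (h x).1.2, continuous_snd.comp (continuous_subtype_val.comp hh)⟩, fun x => ?_⟩
  have hx : (h x).1.1 = x := congrFun hlift x
  have hmem : ((h x).1.1, (h x).1.2) ∈ E := (h x).2
  rwa [hx] at hmem

theorem exists_forall_eq_of_pairwise_disjoint {ι : Type*} {V : ι → Set X}
    (hV : ∀ i, IsOpen (V i)) (hdisj : Pairwise (Disjoint on V)) {y : ι → ℝ} {b : X → ℝ}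
    (hb : Continuous b) (hb₀ : ∀ x, 0 ≤ b x) (hy : ∀ i, ∀ x ∈ V i, |y i| ≤ b x) :
    ∃ f : Cp X, (∀ x, |f.1 x| ≤ b x) ∧ ∀ i, ∀ x ∈ V i, f.1 x = y i := by
  let E : Set (X × ℝ) := {p | |p.2| ≤ b p.1} ∩ ⋂ i, ((V i)ᶜ ×ˢ univ ∪ univ ×ˢ {y i})
  have hmem {x : X} {t : ℝ} : (x, t) ∈ E ↔ |t| ≤ b x ∧ ∀ i, x ∈ V i → t = y i := by
    simp [E, imp_iff_not_or]
  obtain ⟨C, hC⟩ := (isCompact_range hb).bddAbove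
  have hE : IsCompact E := by
    refine (isCompact_univ.prod (isCompact_Icc (a := -C) (b := C))).of_isClosed_subset ?_ ?_
    · exact (isClosed_le continuous_snd.abs (hb.comp continuous_fst)).inter <|
        isClosed_iInter fun i => ((hV i).isClosed_compl.prod isClosed_univ).union
          (isClosed_univ.prod isClosed_singleton)
    · exact fun p hp => ⟨mem_univ _, abs_le.1 (hp.1.trans (hC (mem_range_self _)))⟩
  have hne : ∀ x, ∃ t, (x, t) ∈ E := by
    intro x
    by_cases hx : ∃ i, x ∈ V i
    · obtain ⟨i, hi⟩ := hx
      refine ⟨y i, hmem.2 ⟨hy i x hi, fun j hj => ?_⟩⟩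
      rw [hdisj.eq (not_disjoint_iff.2 ⟨x, hi, hj⟩)]
    · exact ⟨0, hmem.2 ⟨by simpa using hb₀ x, fun i hi => absurd ⟨i, hi⟩ hx⟩⟩
  obtain ⟨f, hf⟩ := exists_continuous_selection hE hne
  exact ⟨f, fun x => (hmem.1 (hf x)).1, fun i x hx => (hmem.1 (hf x)).2 i hx⟩

theorem exists_forall_eq_of_isClopen {ι : Type*} {V : ι → Set X} (hV : ∀ i, IsOpen (V i))
    (hdisj : Pairwise (Disjoint on V)) {K : Set X} (hK : IsClopen K) {y : ι → ℝ} {C ε : ℝ}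
    (hε : 0 ≤ ε) (hC : ∀ i, |y i| ≤ C) (hy : ∀ i, V i ⊆ K ∨ |y i| ≤ ε) :
    ∃ f : Cp X, (∀ x ∉ K, |f.1 x| ≤ ε) ∧ ∀ i, ∀ x ∈ V i, f.1 x = y i := by
  let b (x : X) : ℝ := ε + K.indicator (fun _ => |C|) x
  have hεb (x : X) : ε ≤ b x := le_add_of_nonneg_right (indicator_nonneg (by simp) x)
  have hyb (i : ι) (x : X) (hx : x ∈ V i) : |y i| ≤ b x := by
    obtain hiK | hi := hy i
    · simp only [b, indicator_of_mem (hiK hx)]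
      exact (hC i).trans ((le_abs_self C).trans (le_add_of_nonneg_left hε))
    · exact hi.trans (hεb x)
  obtain ⟨f, hfb, hfV⟩ := exists_forall_eq_of_pairwise_disjoint hV hdisj
    (continuous_const.add (hK.continuous_indicator continuous_const))
    (fun x => hε.trans (hεb x)) hyb
  exact ⟨f, fun x hx => by simpa [indicator_of_notMem hx] using hfb x, hfV⟩

end Extension

section MassOn

variable {X : Type*}

/-- `massOn μ A` is the total variation `|μ|(A)` of the finitely supported signed measure
`∑ x, μ x • δ_x`, which is encoded by its weights `μ : X →₀ ℝ`. -/
noncomputable def massOn (μ : X →₀ ℝ) (A : Set X) : ℝ :=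
  ∑ x ∈ μ.support, A.indicator (fun x => |μ x|) x

theorem massOn_univ (μ : X →₀ ℝ) : massOn μ univ = ∑ x ∈ μ.support, |μ x| := by
  simp [massOn]

theorem sum_massOn_le {ι : Type*} (μ : X →₀ ℝ) {s : Finset ι} {A : ι → Set X}
    (hA : (s : Set ι).PairwiseDisjoint A) : ∑ i ∈ s, massOn μ (A i) ≤ massOn μ univ := by
  simp only [massOn]
  rw [Finset.sum_comm]
  refine Finset.sum_le_sum fun x _ => ?_
  rw [← Finset.indicator_biUnion_apply _ _ (fun i hi j hj hij => hA hi hj hij)]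
  exact indicator_le_indicator_of_subset (subset_univ _) (fun _ => abs_nonneg _) x

theorem massOn_biUnion_le {ι : Type*} (μ : X →₀ ℝ) (s : Finset ι) (A : ι → Set X) :
    massOn μ (⋃ i ∈ s, A i) ≤ ∑ i ∈ s, massOn μ (A i) := by
  simp only [massOn]
  rw [Finset.sum_comm]
  refine Finset.sum_le_sum fun x _ => ?_
  have hnonneg (i : ι) : 0 ≤ (A i).indicator (fun x => |μ x|) x :=
    indicator_nonneg (fun _ _ => abs_nonneg _) x
  by_cases hx : x ∈ ⋃ i ∈ s, A i
  swap
  · rw [indicator_of_notMem hx]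
    exact Finset.sum_nonneg fun i _ => hnonneg i
  obtain ⟨i, hi, hxi⟩ := mem_iUnion₂.1 hx
  rw [indicator_of_mem hx, ← indicator_of_mem hxi fun x => |μ x|]
  exact Finset.single_le_sum (fun i _ => hnonneg i) hi

variable [TopologicalSpace X] [T2Space X] [ExtremallyDisconnected X]

theorem finite_forall_isClopen_not_eventually_massOn_lt {ι : Type*} {μ : ι → X →₀ ℝ} {C : ℝ}
    (hμ : ∀ n, massOn (μ n) univ ≤ C) (hdisj : Pairwise (Disjoint on fun n => (μ n).support))
    (𝒰 : Ultrafilter ι) {ε : ℝ} (hε : 0 < ε) :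
    {n | ∀ V, IsClopen V → ↑(μ n).support ⊆ V → ¬ ∀ᶠ k in 𝒰, massOn (μ k) V < ε}.Finite := by
  by_contra hinf
  obtain ⟨N, hN⟩ := exists_nat_gt (C / ε)
  obtain ⟨s, hs, hcard⟩ := Set.Infinite.exists_subset_card_eq hinf N
  obtain ⟨V, hVclopen, hV, hVdisj⟩ := exists_pairwiseDisjoint_isClopen s.finite_toSet
    (F := fun n => ((μ n).support : Set X)) (fun n _ => Finset.finite_toSet _)
    (fun m _ n _ hmn => Finset.disjoint_coe.2 (hdisj hmn))
  have hlarge : ∀ᶠ k in 𝒰, ∀ n ∈ s, ε ≤ massOn (μ k) (V n) :=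
    (eventually_all_finset s).2 fun n hn => by
      simpa only [not_lt] using Ultrafilter.eventually_not.2 (hs hn (V n) (hVclopen n) (hV n hn))
  obtain ⟨k, hk⟩ := hlarge.exists
  have : N * ε ≤ C := calc
    N * ε = ∑ _n ∈ s, ε := by rw [Finset.sum_const, nsmul_eq_mul, hcard]
    _ ≤ ∑ n ∈ s, massOn (μ k) (V n) := Finset.sum_le_sum hk
    _ ≤ C := (sum_massOn_le (μ k) hVdisj).trans (hμ k)
  exact absurd this (not_le.2 ((div_lt_iff₀ hε).1 hN))

theorem exists_strictMono_sum_massOn_le {μ : ℕ → X →₀ ℝ} {C : ℝ}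
    (hμ : ∀ n, massOn (μ n) univ ≤ C) (hdisj : Pairwise (Disjoint on fun n => (μ n).support))
    {δ : ℝ} (hδ : 0 < δ) :
    ∃ (φ : ℕ → ℕ) (V : ℕ → Set X), StrictMono φ ∧ (∀ l, IsClopen (V l)) ∧
      (∀ l, ↑(μ (φ l)).support ⊆ V l) ∧
      ∀ l, ∑ j ∈ Finset.range l, massOn (μ (φ l)) (V j) ≤ δ := by
  let 𝒰 : Ultrafilter ℕ := .of atTop
  have h𝒰 : ↑𝒰 ≤ (atTop : Filter ℕ) := Ultrafilter.of_le atTop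
  let ε (l : ℕ) : ℝ := δ / 2 * (1 / 2) ^ l
  have hε (l : ℕ) : 0 < ε l := by positivity
  obtain ⟨c, hc, hclt⟩ := exists_seq_of_forall_finset_exists
    (fun p : ℕ × ℕ × Set X => IsClopen p.2.2 ∧ ↑(μ p.2.1).support ⊆ p.2.2 ∧
      ∀ᶠ k in 𝒰, massOn (μ k) p.2.2 < ε p.1)
    (fun p q => p.1 < q.1 ∧ p.2.1 < q.2.1 ∧ massOn (μ q.2.1) p.2.2 < ε p.1) (by
      intro s hs
      let l := s.sup Prod.fst + 1
      have hl : ∀ p ∈ s, p.1 < l := fun p hp => Nat.lt_succ_of_le (Finset.le_sup (f := Prod.fst) hp)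
      have hgood := (finite_forall_isClopen_not_eventually_massOn_lt
        hμ hdisj 𝒰 (hε l)).eventually_cofinite_notMem
      rw [Nat.cofinite_eq_atTop] at hgood
      have hs' : ∀ᶠ n in 𝒰, ∀ p ∈ s, p.2.1 < n ∧ massOn (μ n) p.2.2 < ε p.1 :=
        (eventually_all_finset s).2 fun p hp =>
          ((eventually_gt_atTop p.2.1).filter_mono h𝒰).and (hs p hp).2.2
      obtain ⟨n, hn, hns⟩ := ((hgood.filter_mono h𝒰).and hs').exists
      simp only [mem_ofPred_eq, not_forall, not_not] at hn
      obtain ⟨V, hV, hnV, hVε⟩ := hn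
      exact ⟨(l, n, V), ⟨hV, hnV, hVε⟩, fun p hp => ⟨hl p hp, hns p hp⟩⟩)
  have hlevel (l : ℕ) : l ≤ (c l).1 :=
    StrictMono.le_apply (f := fun l => (c l).1) fun i j h => (hclt i j h).1
  refine ⟨fun l => (c l).2.1, fun l => (c l).2.2, fun i j h => (hclt i j h).2.1,
    fun l => (hc l).1, fun l => (hc l).2.1, fun l => ?_⟩
  calc
    _ ≤ ∑ j ∈ Finset.range l, δ / 2 * (1 / 2) ^ j := Finset.sum_le_sum fun j hj =>
      (hclt j l (Finset.mem_range.1 hj)).2.2.le.trans <| mul_le_mul_of_nonneg_left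
        (pow_le_pow_of_le_one (by norm_num) (by norm_num) (hlevel j)) (half_pos hδ).le
    _ = δ / 2 * ∑ j ∈ Finset.range l, (1 / 2) ^ j := Finset.mul_sum .. |>.symm
    _ ≤ δ / 2 * 2 := mul_le_mul_of_nonneg_left (sum_geometric_two_le l) (half_pos hδ).le
    _ = δ := div_mul_cancel₀ δ two_ne_zero

end MassOn

namespace Cp

section Integral

variable {X : Type*} [TopologicalSpace X]

/-- The Dirac functional `δ_x` on `C_p(X)`. -/
def dirac (x : X) : StrongDual ℝ (Cp X) :=
  (ContinuousLinearMap.proj x).comp (Cp X).subtypeL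

/-- Integration of continuous functions against the finitely supported signed measure
`∑ x, μ x • δ_x`, which is encoded by its weights `μ : X →₀ ℝ`. -/
noncomputable def integral : (X →₀ ℝ) →ₗ[ℝ] StrongDual ℝ (Cp X) :=
  Finsupp.linearCombination ℝ dirac

theorem integral_apply (μ : X →₀ ℝ) (f : Cp X) :
    integral μ f = ∑ x ∈ μ.support, μ x * f.1 x := by
  simp [integral, Finsupp.linearCombination_apply, Finsupp.sum, dirac]

theorem exists_forall_abs_le [CompactSpace X] (f : Cp X) : ∃ C, ∀ x, |f.1 x| ≤ C :=
  (isCompact_range f.2.abs).bddAbove.imp fun _ => forall_mem_range.1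

theorem abs_integral_le (μ : X →₀ ℝ) (f : Cp X) {C : ℝ} (hf : ∀ x, |f.1 x| ≤ C) :
    |integral μ f| ≤ massOn μ univ * C := by
  rw [integral_apply, massOn_univ, Finset.sum_mul]
  refine (Finset.abs_sum_le_sum_abs _ _).trans (Finset.sum_le_sum fun x _ => ?_)
  rw [abs_mul]
  exact mul_le_mul_of_nonneg_left (hf x) (abs_nonneg _)

theorem massOn_sub_le_integral (μ : X →₀ ℝ) {A : Set X} {f : Cp X} (hf : ∀ x, |f.1 x| ≤ 1)
    (hA : ∀ x ∈ μ.support, x ∉ A → f.1 x = SignType.sign (μ x)) :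
    massOn μ univ - 2 * massOn μ A ≤ integral μ f := by
  rw [integral_apply, massOn_univ]
  simp only [massOn]
  rw [Finset.mul_sum, ← Finset.sum_sub_distrib]
  refine Finset.sum_le_sum fun x hx => ?_
  by_cases hxA : x ∈ A
  · have hneg : -|μ x| ≤ μ x * f.1 x := by
      refine (neg_le_neg ?_).trans (neg_abs_le _)
      rw [abs_mul]
      exact mul_le_of_le_one_right (abs_nonneg _) (hf x)
    rw [indicator_of_mem hxA]
    linarith
  · rw [indicator_of_notMem hxA, hA x hx hxA, mul_comm (μ x), sign_mul_self]
    linarith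

theorem integral_surjective : Surjective (integral : (X →₀ ℝ) →ₗ[ℝ] StrongDual ℝ (Cp X)) := by
  intro φ
  have htop : (inferInstance : TopologicalSpace (Cp X)) =
      ⨅ x, TopologicalSpace.induced (dirac x).toLinearMap inferInstance := by
    simp only [instTopologicalSpaceSubtype, Pi.topologicalSpace, induced_iInf, induced_compose]
    rfl
  have hφ := (LinearMap.mem_span_iff_continuous
    (f := fun x : X => (dirac x).toLinearMap) φ.toLinearMap).2 (htop ▸ φ.continuous)
  obtain ⟨μ, hμ⟩ := Finsupp.mem_span_range_iff_exists_finsupp.1 hφ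
  refine ⟨μ, ContinuousLinearMap.ext fun f => ?_⟩
  have := LinearMap.congr_fun hμ f
  simpa [integral, Finsupp.linearCombination_apply, Finsupp.sum] using this

end Integral

section JosefsonNissenzweig

variable {X : Type*} [TopologicalSpace X] [CompactSpace X] [T2Space X] [ExtremallyDisconnected X]

theorem exists_massOn_sub_le_integral (μ : ℕ → X →₀ ℝ) {V : ℕ → Set X}
    (hV : ∀ n, IsClopen (V n)) (hsupp : ∀ n, ↑(μ n).support ⊆ V n) :
    ∃ f : Cp X, ∀ n,
      massOn (μ n) univ - 2 * ∑ j ∈ Finset.range n, massOn (μ n) (V j) ≤ integral (μ n) f := by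
  choose U hU hUdisj using fun n => (μ n).support.finite_toSet.t2_separation
  let W (p : Σ n, (μ n).support) : Set X := U p.1 p.2 ∩ disjointed V p.1
  have hWopen (p) : IsOpen (W p) := (hU p.1 p.2).2.inter
    (disjointedRec (f := V) (p := IsClopen) (fun _ _ h => h.diff (hV _)) (hV p.1)).isOpen
  have hWdisj : Pairwise (Disjoint on W) := by
    rintro ⟨m, x⟩ ⟨n, z⟩ hne
    obtain rfl | hmn := eq_or_ne m n
    · exact (hUdisj m x.2 z.2 fun h => hne (by rw [Subtype.ext h])).mono inf_le_left inf_le_left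
    · exact (disjoint_disjointed V hmn).mono inf_le_right inf_le_right
  obtain ⟨f, hf, hfW⟩ := exists_forall_eq_of_pairwise_disjoint hWopen hWdisj
    (y := fun p => SignType.sign (μ p.1 p.2)) (b := 1) continuous_const (by simp)
    (fun p x _ => by cases SignType.sign (μ p.1 p.2) <;> simp)
  refine ⟨f, fun n => ?_⟩
  have hsign : ∀ x ∈ (μ n).support, x ∉ ⋃ j ∈ Finset.range n, V j →
      f.1 x = SignType.sign (μ n x) := by
    intro x hx hxV
    refine hfW ⟨n, x, hx⟩ x ⟨(hU n x).1, ?_⟩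
    rw [disjointed_eq_inter_compl]
    simpa [hsupp n hx] using hxV
  linarith [massOn_sub_le_integral (μ n) hf hsign, massOn_biUnion_le (μ n) (Finset.range n) V]

theorem exists_not_tendsto_integral_zero {μ : ℕ → X →₀ ℝ} (hμ : ∀ n, massOn (μ n) univ = 1)
    (hdisj : Pairwise (Disjoint on fun n => (μ n).support)) :
    ∃ f : Cp X, ¬ Tendsto (fun n => integral (μ n) f) atTop (𝓝 0) := by
  obtain ⟨φ, V, hφ, hV, hsupp, hsum⟩ :=
    exists_strictMono_sum_massOn_le (fun n => (hμ n).le) hdisj (δ := 1 / 4) (by norm_num)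
  obtain ⟨f, hf⟩ := exists_massOn_sub_le_integral (fun l => μ (φ l)) hV hsupp
  refine ⟨f, fun hlim => ?_⟩
  have hle (l : ℕ) : 1 / 2 ≤ integral (μ (φ l)) f := by linarith [hf l, hμ (φ l), hsum l]
  exact absurd (ge_of_tendsto' (hlim.comp hφ.tendsto_atTop) hle) (by norm_num)

end JosefsonNissenzweig

end Cp

section LinearAlgebra

variable {X : Type*}

theorem exists_mem_massOn_eq_one {W : Submodule ℝ (X →₀ ℝ)} (hW : ¬ FiniteDimensional ℝ W)
    {V : Type*} [AddCommGroup V] [Module ℝ V] [FiniteDimensional ℝ V] (T : (X →₀ ℝ) →ₗ[ℝ] V) :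
    ∃ μ ∈ W, massOn μ univ = 1 ∧ T μ = 0 := by
  have hmeet : ¬ Disjoint W (LinearMap.ker T) := fun h =>
    hW (Module.Finite.of_injective (T.domRestrict W) (LinearMap.injective_domRestrict_iff.2 h))
  obtain ⟨ν, hνW, hν, hν0⟩ : ∃ ν ∈ W, ν ∈ LinearMap.ker T ∧ ν ≠ 0 := by
    simpa [Submodule.disjoint_def] using hmeet
  have hpos : 0 < massOn ν univ := by
    rw [massOn_univ]
    exact Finset.sum_pos (fun x hx => abs_pos.2 (Finsupp.mem_support_iff.1 hx))
      (Finsupp.support_nonempty_iff.2 hν0)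
  refine ⟨(massOn ν univ)⁻¹ • ν, W.smul_mem _ hνW, ?_, (LinearMap.ker T).smul_mem _ hν⟩
  rw [massOn_univ, Finsupp.support_smul_eq (inv_ne_zero hpos.ne')]
  simp only [Finsupp.smul_apply, smul_eq_mul, abs_mul, ← Finset.mul_sum, ← massOn_univ]
  rw [abs_of_pos (inv_pos.2 hpos), inv_mul_cancel₀ hpos.ne']

theorem exists_seq_mem_massOn_eq_one {W : Submodule ℝ (X →₀ ℝ)} (hW : ¬ FiniteDimensional ℝ W)
    (d : ℕ → Module.Dual ℝ (X →₀ ℝ)) :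
    ∃ μ : ℕ → X →₀ ℝ, (∀ n, μ n ∈ W) ∧ (∀ n, massOn (μ n) univ = 1) ∧
      Pairwise (Disjoint on fun n => (μ n).support) ∧ ∀ n, ∀ k < n, d k (μ n) = 0 := by
  classical
  obtain ⟨c, hc, hclt⟩ := exists_seq_of_forall_finset_exists
    (fun p : ℕ × (X →₀ ℝ) => p.2 ∈ W ∧ massOn p.2 univ = 1 ∧ ∀ k < p.1, d k p.2 = 0)
    (fun p q => p.1 < q.1 ∧ Disjoint p.2.support q.2.support) (by
      intro s _
      let l := s.sup Prod.fst + 1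
      have hl : ∀ p ∈ s, p.1 < l := fun p hp => Nat.lt_succ_of_le (Finset.le_sup (f := Prod.fst) hp)
      let A := s.biUnion fun p => p.2.support
      obtain ⟨μ, hμW, hμ1, hμ0⟩ := exists_mem_massOn_eq_one hW
        ((LinearMap.pi fun k : Fin l => d k).prod (LinearMap.pi fun x : A => Finsupp.lapply x.1))
      have hd : ∀ k < l, d k μ = 0 := fun k hk => congrFun (congrArg Prod.fst hμ0) ⟨k, hk⟩
      have hA : ∀ x ∈ A, μ x = 0 := fun x hx => congrFun (congrArg Prod.snd hμ0) ⟨x, hx⟩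
      refine ⟨(l, μ), ⟨hμW, hμ1, hd⟩, fun p hp => ⟨hl p hp, Finset.disjoint_left.2 fun x hx => ?_⟩⟩
      exact Finsupp.notMem_support_iff.2 (hA x (Finset.mem_biUnion.2 ⟨p, hp, hx⟩)))
  have hlevel (n : ℕ) : n ≤ (c n).1 :=
    StrictMono.le_apply (f := fun n => (c n).1) fun i j h => (hclt i j h).1
  refine ⟨fun n => (c n).2, fun n => (hc n).1, fun n => (hc n).2.1, ?_,
    fun n k hk => (hc n).2.2 k (hk.trans_le (hlevel n))⟩
  intro m n hmn
  obtain h | h := hmn.lt_or_gt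
  · exact (hclt m n h).2
  · exact (hclt n m h).2.symm

end LinearAlgebra

theorem tendsto_zero_of_dense {F : Type*} [AddCommGroup F] [Module ℝ F] [UniformSpace F]
    [IsUniformAddGroup F] [ContinuousSMul ℝ F] [BarrelledSpace ℝ F] {ψ : ℕ → StrongDual ℝ F}
    (hbdd : ∀ x, ∃ C, ∀ n, |ψ n x| ≤ C) {s : Set F} (hs : Dense s)
    (hlim : ∀ x ∈ s, Tendsto (fun n => ψ n x) atTop (𝓝 0)) (x : F) :
    Tendsto (fun n => ψ n x) atTop (𝓝 0) := by
  have hequi : Equicontinuous fun n => ⇑(ψ n) :=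
    ((norm_withSeminorms ℝ ℝ).banach_steinhaus fun _ x => by
      obtain ⟨C, hC⟩ := hbdd x
      exact ⟨C, forall_mem_range.2 hC⟩).equicontinuous
  exact (hequi x).tendsto_of_mem_closure tendsto_const_nhds hlim (hs x)

theorem barrelledSpace_of_completeSpace {F : Type*} [AddCommGroup F] [Module ℝ F] [UniformSpace F]
    [IsUniformAddGroup F] [ContinuousSMul ℝ F] [TopologicalSpace.MetrizableSpace F]
    [CompleteSpace F] : BarrelledSpace ℝ F := by
  have := IsUniformAddGroup.uniformity_countably_generated (α := F)
  infer_instance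

theorem exists_strongDual_eq_zero_ne_zero {E : Type*} [AddCommGroup E] [Module ℝ E]
    [TopologicalSpace E] [IsTopologicalAddGroup E] [ContinuousSMul ℝ E] [LocallyConvexSpace ℝ E]
    {Z : Submodule ℝ E} (hZ : IsClosed (Z : Set E)) {x : E} (hx : x ∉ Z) :
    ∃ φ : StrongDual ℝ E, (∀ z ∈ Z, φ z = 0) ∧ φ x ≠ 0 := by
  obtain ⟨φ, u, hφZ, hφx⟩ := geometric_hahn_banach_closed_point Z.convex hZ hx
  have hu : 0 < u := by simpa using hφZ 0 Z.zero_mem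
  refine ⟨φ, fun z hz => ?_, (hu.trans hφx).ne'⟩
  by_contra hne
  have := hφZ ((u / φ z) • z) (Z.smul_mem _ hz)
  rw [map_smul, smul_eq_mul, div_mul_cancel₀ _ hne] at this
  exact lt_irrefl _ this

namespace Cp

section Annihilator

variable {X : Type*} [TopologicalSpace X]

/-- The annihilator `Z^⊥` of a subspace `Z` of `C_p(X)`, taken inside the space of finitely
supported measures, which is the dual of `C_p(X)`. -/
noncomputable def annihilator (Z : Submodule ℝ (Cp X)) : Submodule ℝ (X →₀ ℝ) :=
  Z.dualAnnihilator.comap ((ContinuousLinearMap.coeLM ℝ).comp integral)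

theorem mem_annihilator {Z : Submodule ℝ (Cp X)} {μ : X →₀ ℝ} :
    μ ∈ annihilator Z ↔ ∀ f ∈ Z, integral μ f = 0 :=
  Submodule.mem_dualAnnihilator _

theorem mem_of_forall_integral_eq_zero {Z : Submodule ℝ (Cp X)} (hZ : IsClosed (Z : Set (Cp X)))
    {f : Cp X} (hf : ∀ μ ∈ annihilator Z, integral μ f = 0) : f ∈ Z := by
  by_contra hfZ
  obtain ⟨φ, hφZ, hφf⟩ := exists_strongDual_eq_zero_ne_zero hZ hfZ
  obtain ⟨μ, rfl⟩ := integral_surjective φ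
  exact hφf (hf μ (mem_annihilator.2 hφZ))

theorem finiteDimensional_quotient_of_annihilator {Z : Submodule ℝ (Cp X)}
    (hZ : IsClosed (Z : Set (Cp X))) [FiniteDimensional ℝ (annihilator Z)] :
    FiniteDimensional ℝ (Cp X ⧸ Z) := by
  let J : (X →₀ ℝ) →ₗ[ℝ] Module.Dual ℝ (Cp X) := (ContinuousLinearMap.coeLM ℝ).comp integral
  have hle : ((annihilator Z).map J).dualCoannihilator ≤ Z := fun f hf =>
    mem_of_forall_integral_eq_zero hZ fun μ hμ =>
      (Submodule.mem_dualCoannihilator f).1 hf _ (Submodule.mem_map_of_mem hμ)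
  have hmap : FiniteDimensional ℝ ((annihilator Z).map J) := inferInstance
  have := Subspace.finiteDimensional_quot_dualCoannihilator_iff.2 hmap
  exact Module.Finite.of_surjective (Submodule.factor hle) (Submodule.factor_surjective hle)

end Annihilator

section Quotient

variable {X : Type*} [TopologicalSpace X] [CompactSpace X] [T2Space X] [ExtremallyDisconnected X]

theorem finiteDimensional_quotient_of_surjective {F : Type*} [AddCommGroup F] [Module ℝ F]
    [UniformSpace F] [IsUniformAddGroup F] [ContinuousSMul ℝ F] [BarrelledSpace ℝ F]
    [TopologicalSpace.SeparableSpace F] {Z : Submodule ℝ (Cp X)} (hZ : IsClosed (Z : Set (Cp X)))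
    {S : F →L[ℝ] Cp X ⧸ Z} (hS : Surjective S) : FiniteDimensional ℝ (Cp X ⧸ Z) := by
  by_contra hfin
  have hW : ¬ FiniteDimensional ℝ (annihilator Z) :=
    fun _ => hfin (finiteDimensional_quotient_of_annihilator hZ)
  choose g hg using fun x : F => Submodule.mkQ_surjective Z (S x)
  let u := TopologicalSpace.denseSeq F
  obtain ⟨μ, hμZ, hμ1, hdisj, hμ0⟩ := exists_seq_mem_massOn_eq_one hW fun k =>
    (LinearMap.applyₗ (g (u k))).comp ((ContinuousLinearMap.coeLM ℝ).comp integral)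
  let ψ (n : ℕ) : StrongDual ℝ F :=
    (Z.liftQL (integral (μ n)) (mem_annihilator.1 (hμZ n))).comp S
  have hψ (n : ℕ) {x : F} {f : Cp X} (hf : Z.mkQ f = S x) : ψ n x = integral (μ n) f := by
    simp only [ψ, ContinuousLinearMap.comp_apply, ← hf]
    rfl
  have hbdd (x : F) : ∃ C, ∀ n, |ψ n x| ≤ C := by
    obtain ⟨C, hC⟩ := exists_forall_abs_le (g x)
    refine ⟨C, fun n => ?_⟩
    rw [hψ n (hg x)]
    simpa [hμ1] using abs_integral_le (μ n) (g x) hC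
  have hnull (x : F) (hx : x ∈ range u) : Tendsto (fun n => ψ n x) atTop (𝓝 0) := by
    obtain ⟨k, rfl⟩ := hx
    refine tendsto_const_nhds.congr' ((eventually_gt_atTop k).mono fun n hn => ?_)
    exact ((hψ n (hg _)).trans (hμ0 n k hn)).symm
  obtain ⟨f, hf⟩ := exists_not_tendsto_integral_zero hμ1 hdisj
  obtain ⟨x, hx⟩ := hS (Z.mkQ f)
  refine hf ((tendsto_zero_of_dense hbdd (TopologicalSpace.denseRange_denseSeq F) hnull x).congr
    fun n => hψ n hx.symm)

theorem finiteDimensional_quotient_of_isPolishable {Z : Submodule ℝ (Cp X)}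
    (hZ : IsClosed (Z : Set (Cp X))) (hpol : IsPolishable (Cp X ⧸ Z)) :
    FiniteDimensional ℝ (Cp X ⧸ Z) := by
  obtain ⟨u, hfiner, hgroup, hsmul, -, hmetr, hcomplete, hsep⟩ := hpol
  have hbarr := @barrelledSpace_of_completeSpace (Cp X ⧸ Z) _ _ u hgroup hsmul hmetr hcomplete
  let S := @ContinuousLinearMap.mk ℝ ℝ _ _ (.id ℝ) (Cp X ⧸ Z) u.toTopologicalSpace _ (Cp X ⧸ Z)
    _ _ _ _ .id (continuous_id_iff_le.2 hfiner)
  exact @finiteDimensional_quotient_of_surjective X _ _ _ _ (Cp X ⧸ Z) _ _ u hgroup hsmul hbarr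
    hsep Z hZ S surjective_id

end Quotient

end Cp

namespace cZero

/-- The extension of null sequences by the value `0` at infinity, which embeds `c_0` into
`C_p(ℕ ∪ {∞})`. -/
noncomputable def extend : cZero →L[ℝ] Cp ℕ∞ where
  toFun y := ⟨ENat.recTopCoe 0 y.1, continuous_iff_continuousAt.2 fun k => by
    induction k using ENat.recTopCoe with
    | coe n => simpa only [ContinuousAt, ENat.nhds_natCast] using tendsto_pure_nhds _ (n : ℕ∞)
    | top =>
      refine Metric.tendsto_nhds.2 fun ε hε => ?_
      obtain ⟨N, hN⟩ := eventually_atTop.1 (Metric.tendsto_nhds.1 y.2 ε hε)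
      filter_upwards [lt_mem_nhds (ENat.natCast_lt_top N)] with k hk
      induction k using ENat.recTopCoe with
      | coe n => exact hN n (Nat.cast_lt.1 hk).le
      | top => simpa using hε⟩
  map_add' y z := by ext k; cases k <;> simp
  map_smul' c y := by ext k; cases k <;> simp
  cont := by
    refine Continuous.subtype_mk (continuous_pi fun k => ?_) _
    induction k using ENat.recTopCoe with
    | coe n => exact (continuous_apply n).comp continuous_subtype_val
    | top => exact continuous_const

theorem exists_surjective_continuousMap : ∃ T : C(ℕ∞, ℝ) →L[ℝ] cZero, Surjective T := by
  let T : C(ℕ∞, ℝ) →L[ℝ] ℕ → ℝ :=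
    .pi fun n => ContinuousMap.evalCLM ℝ (n : ℕ∞) - ContinuousMap.evalCLM ℝ (⊤ : ℕ∞)
  have hT (g : C(ℕ∞, ℝ)) : T g ∈ cZero := by
    have hg := ((map_continuous g).tendsto ⊤).comp ENat.tendsto_natCast_nhds_top
    simpa using! hg.sub_const (g ⊤)
  refine ⟨T.codRestrict cZero hT, fun y => ⟨⟨(extend y).1, (extend y).2⟩, ?_⟩⟩
  ext n
  simp [T, extend]

theorem not_finiteDimensional : ¬ FiniteDimensional ℝ cZero := by
  intro hfin
  have hmem (n : ℕ) : Pi.single n (1 : ℝ) ∈ cZero :=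
    tendsto_const_nhds.congr' ((eventually_gt_atTop n).mono fun m hm =>
      (Pi.single_eq_of_ne (M := fun _ => ℝ) hm.ne' 1).symm)
  have hind : LinearIndependent ℝ fun n => (⟨Pi.single n 1, hmem n⟩ : cZero) :=
    .of_comp cZero.subtype (Pi.linearIndependent_single_one ℕ ℝ)
  exact Infinite.not_finite hind.finite

end cZero

theorem exists_continuousMap_enat {X : Type*} [TopologicalSpace X] {V : ℕ → Set X}
    (hV : ∀ n, IsClopen (V n)) (hdisj : Pairwise (Disjoint on V)) :
    ∃ q : C(X, ℕ∞), ∀ n, ∀ x ∈ V n, q x = n := by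
  let q : X → ℕ∞ := fun x => ⨅ (n : ℕ) (_ : x ∈ V n), (n : ℕ∞)
  have hIio (a : ℕ∞) : q ⁻¹' Iio a = ⋃ (n : ℕ) (_ : (n : ℕ∞) < a), V n := by
    ext x
    simp [q, iInf_lt_iff, and_comm]
  have hIic (n : ℕ) : q ⁻¹' Iic (n : ℕ∞) = ⋃ m ∈ Iic n, V m := by
    have hsucc (a : ℕ∞) : a ≤ n ↔ a < n + 1 := (ENat.lt_add_one_iff (ENat.natCast_ne_top n)).symm
    ext x
    simp [q, hsucc, iInf_lt_iff, and_comm, ← Nat.lt_add_one_iff, ← Nat.cast_lt (α := ℕ∞)]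
  refine ⟨⟨q, OrderTopology.continuous_iff.2 fun a => ⟨?_, ?_⟩⟩, fun n x hx => ?_⟩
  · induction a using ENat.recTopCoe with
    | coe n =>
      rw [← compl_Iic, preimage_compl, hIic]
      exact ((finite_Iic n).isClosed_biUnion fun m _ => (hV m).isClosed).isOpen_compl
    | top => simp
  · rw [hIio]
    exact isOpen_iUnion fun n => isOpen_iUnion fun _ => (hV n).isOpen
  · refine le_antisymm (iInf₂_le n hx) (le_iInf₂ fun m hm => ?_)
    rw [hdisj.eq (not_disjoint_iff.2 ⟨x, hm, hx⟩)]

namespace Cp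

section Separable

variable {X : Type*} [TopologicalSpace X]

/-- The continuous linear map `g ↦ g ∘ q` from the Banach space `C(K, ℝ)` to `C_p(X)`. -/
def pullback {K : Type*} [TopologicalSpace K] (q : C(X, K)) : C(K, ℝ) →L[ℝ] Cp X :=
  (ContinuousLinearMap.pi fun x => ContinuousMap.evalCLM ℝ (q x)).codRestrict (Cp X)
    fun g => map_continuous (g.comp q)

theorem exists_pullback_eq_of_separableSpace [CompactSpace X] (S : Submodule ℝ (Cp X))
    [TopologicalSpace.SeparableSpace S] :
    ∃ (K : Set (ℕ → ℝ)) (q : C(X, K)), IsCompact K ∧ ∀ f ∈ S, ∃ g, pullback q g = f := by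
  let s := TopologicalSpace.denseSeq S
  let Φ : X → ℕ → ℝ := fun x n => (s n).1.1 x
  have hΦ : Continuous Φ := continuous_pi fun n => (s n).1.2
  let q : C(X, range Φ) := ⟨rangeFactorization Φ, hΦ.rangeFactorization⟩
  have hq : IsQuotientMap q := .of_surjective_continuous rangeFactorization_surjective q.continuous
  refine ⟨range Φ, q, isCompact_range hΦ, fun f hf => ?_⟩
  have hfib (x x' : X) (hx : q x = q x') : f.1 x = f.1 x' := by
    have hclosed : IsClosed {h : S | h.1.1 x = h.1.1 x'} :=
      isClosed_eq ((dirac x).continuous.comp continuous_subtype_val)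
        ((dirac x').continuous.comp continuous_subtype_val)
    have hsub : range s ⊆ {h : S | h.1.1 x = h.1.1 x'} :=
      range_subset_iff.2 fun n => congrFun (congrArg Subtype.val hx) n
    exact hclosed.closure_subset_iff.2 hsub (TopologicalSpace.denseRange_denseSeq S ⟨f, hf⟩)
  refine ⟨hq.lift ⟨f.1, f.2⟩ hfib, Subtype.ext (funext fun x => ?_)⟩
  exact congrArg (· x) (hq.lift_comp ⟨f.1, f.2⟩ hfib)

theorem finiteDimensional_of_closedComplemented [CompactSpace X] [T2Space X]
    [ExtremallyDisconnected X] {S : Submodule ℝ (Cp X)} (hS : S.ClosedComplemented)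
    [TopologicalSpace.SeparableSpace S] : FiniteDimensional ℝ S := by
  obtain ⟨P, hP⟩ := hS
  obtain ⟨K, q, hK, hq⟩ := exists_pullback_eq_of_separableSpace S
  have := isCompact_iff_compactSpace.1 hK
  have hsurj : Surjective (P.ker.mkQL.comp (pullback q)) := fun z => by
    obtain ⟨f, rfl⟩ := P.ker.mkQ_surjective z
    obtain ⟨g, hg⟩ := hq (P f) (P f).2
    refine ⟨g, (Submodule.Quotient.eq P.ker).2 ?_⟩
    simp [hg, hP]
  have := finiteDimensional_quotient_of_surjective P.isClosed_ker hsurj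
  exact (P.toLinearMap.quotKerEquivOfSurjective fun f => ⟨f.1, hP f⟩).finiteDimensional

end Separable

theorem exists_submodule_equiv_cZero {X : Type*} [TopologicalSpace X] {q : C(X, ℕ∞)}
    (hq : ∀ n : ℕ, ∃ x, q x = n) : ∃ S : Submodule ℝ (Cp X), Nonempty (S ≃L[ℝ] cZero) := by
  choose x hx using hq
  let J : cZero →L[ℝ] Cp X :=
    (ContinuousLinearMap.pi fun z => (dirac (q z)).comp cZero.extend).codRestrict (Cp X)
      fun y => (cZero.extend y).2.comp q.continuous
  have hJ : (ContinuousLinearMap.pi fun n => dirac (x n)) ∘ J = Subtype.val := by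
    ext y n
    change (cZero.extend y).1 (q (x n)) = _
    rw [hx]
    rfl
  have hemb : IsEmbedding J :=
    .of_comp J.continuous (ContinuousLinearMap.pi fun n => dirac (x n)).continuous
      (hJ ▸ IsEmbedding.subtypeVal)
  have hhomeo : IsHomeomorph (LinearEquiv.ofInjective J.toLinearMap hemb.injective) :=
    isHomeomorph_iff_isEmbedding_surjective.2
      ⟨hemb.codRestrict _ _, LinearEquiv.surjective _⟩
  exact ⟨J.range, ⟨(ContinuousLinearEquiv.ofIsHomeomorph _ hhomeo).symm⟩⟩

end Cp

theorem nonempty_quotient_ker_equiv {E F : Type*} [AddCommGroup E] [Module ℝ E]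
    [TopologicalSpace E] [AddCommGroup F] [Module ℝ F] [TopologicalSpace F] {T : E →L[ℝ] F}
    (hT : IsOpenQuotientMap T) : Nonempty ((E ⧸ T.ker) ≃L[ℝ] F) := by
  let e := T.toLinearMap.quotKerEquivOfSurjective hT.surjective
  refine ⟨.ofIsHomeomorph e ⟨?_, ?_, e.bijective⟩⟩
  · exact T.ker.isQuotientMap_mkQL.continuous_iff.2 hT.continuous
  · exact .of_comp T.ker.mkQL.continuous T.ker.mkQ_surjective hT.isOpenMap

theorem exists_disjoint_of_finite {X ι : Type*} [Infinite ι] {K : ι → Set X}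
    (hK : Pairwise (Disjoint on K)) {F : Set X} (hF : F.Finite) : ∃ j, Disjoint F (K j) := by
  by_contra! hmeet
  choose z hzF hzK using fun j => not_disjoint_iff.1 (hmeet j)
  have hinj : Injective z := fun i j hij => hK.eq (not_disjoint_iff.2 ⟨z i, hzK i, hij ▸ hzK j⟩)
  exact infinite_range_of_injective hinj (hF.subset (range_subset_iff.2 hzF))

namespace Cp

theorem hasBasis_nhds_zero {X : Type*} [TopologicalSpace X] :
    (𝓝 (0 : Cp X)).HasBasis (fun p : Set X × ℝ => p.1.Finite ∧ 0 < p.2)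
      fun p => {f | ∀ x ∈ p.1, |f.1 x| ≤ p.2} := by
  rw [nhds_subtype, nhds_pi]
  convert! (Metric.nhds_basis_closedBall (x := (0 : ℝ))).pi_self.comap Subtype.val using 2
  ext f
  simp

section BlockAverage

variable {X : Type*} [TopologicalSpace X] [CompactSpace X]

/-- The operator `f ↦ (∑ i ≤ n, 2⁻ⁱ f(x n i))ₙ` from `C_p(X)` to `ℓ_∞`, for a double sequence `x`
of points of `X`. -/
noncomputable def blockAverage (x : ℕ → ℕ → X) : Cp X →L[ℝ] ellInfty :=
  (ContinuousLinearMap.pi fun n =>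
    ∑ i ∈ Finset.range (n + 1), (1 / 2 : ℝ) ^ i • dirac (x n i)).codRestrict ellInfty fun f => by
      obtain ⟨C, hC⟩ := exists_forall_abs_le f
      have hC₀ : 0 ≤ C := (abs_nonneg _).trans (hC (x 0 0))
      refine ⟨2 * C, fun n => ?_⟩
      simp only [ContinuousLinearMap.coe_pi', sum_apply, smul_apply, smul_eq_mul]
      calc |∑ i ∈ Finset.range (n + 1), (1 / 2 : ℝ) ^ i * dirac (x n i) f|
          ≤ ∑ i ∈ Finset.range (n + 1), |(1 / 2 : ℝ) ^ i * dirac (x n i) f| :=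
            Finset.abs_sum_le_sum_abs _ _
        _ ≤ ∑ i ∈ Finset.range (n + 1), (1 / 2 : ℝ) ^ i * C := by
            gcongr with i
            rw [abs_mul, abs_of_pos (by positivity)]
            gcongr
            exact hC _
        _ ≤ 2 * C := by
            rw [← Finset.sum_mul]
            gcongr
            exact sum_geometric_two_le _

theorem blockAverage_apply (x : ℕ → ℕ → X) (f : Cp X) (n : ℕ) :
    (blockAverage x f).1 n = ∑ i ∈ Finset.range (n + 1), (1 / 2 : ℝ) ^ i * f.1 (x n i) := by
  simp [blockAverage, dirac]

variable [T2Space X] [ExtremallyDisconnected X]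

theorem exists_blockAverage_eq {U : ℕ → ℕ → Set X} (hU : ∀ n i, IsOpen (U n i))
    (hdisj : Pairwise (Disjoint on uncurry U)) {x : ℕ → ℕ → X} (hx : ∀ n i, x n i ∈ U n i)
    (j : ℕ) {y : ellInfty} {ε : ℝ} (hε : 0 ≤ ε) (hy : ∀ n < j, |y.1 n| ≤ ε) :
    ∃ f, blockAverage x f = y ∧ ∀ z ∉ closure (⋃ n, U n j), |f.1 z| ≤ ε := by
  obtain ⟨C, hC⟩ := y.2
  have hC₀ : 0 ≤ C := (abs_nonneg _).trans (hC 0)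
  let K := closure (⋃ n, U n j)
  have hK : IsClopen K :=
    ⟨isClosed_closure, ExtremallyDisconnected.open_closure _ (isOpen_iUnion fun n => hU n j)⟩
  -- Only one point of each block carries the value `y n`: in column `0` as long as `y n` is small,
  -- and in column `j`, away from which `f` has to be small, afterwards.
  let col (n : ℕ) : ℕ := if n < j then 0 else j
  have hcol (n : ℕ) : col n ≤ n ∧ col n ≤ j := by grind
  let w (p : ℕ × ℕ) : ℝ := if p.2 = col p.1 then 2 ^ p.2 * y.1 p.1 else 0
  have hwC (p : ℕ × ℕ) : |w p| ≤ 2 ^ j * C := by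
    by_cases hp : p.2 = col p.1
    · simp only [w, if_pos hp, abs_mul, abs_pow, abs_two]
      gcongr
      exacts [one_le_two, hp ▸ (hcol p.1).2, hC p.1]
    · simpa [w, hp] using by positivity
  have hw (p : ℕ × ℕ) : uncurry U p ⊆ K ∨ |w p| ≤ ε := by
    obtain ⟨n, i⟩ := p
    by_cases hi : i = col n
    swap
    · exact .inr (by simpa [w, hi] using hε)
    by_cases hn : n < j
    · exact .inr (by simpa [w, hi, col, hn] using hy n hn)
    · obtain rfl : i = j := by simpa [col, hn] using hi
      exact .inl ((subset_iUnion (U · i) n).trans subset_closure)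
  obtain ⟨f, hfK, hfU⟩ := exists_forall_eq_of_isClopen (fun p : ℕ × ℕ => hU p.1 p.2) hdisj hK hε
    hwC hw
  refine ⟨f, Subtype.ext (funext fun n => ?_), hfK⟩
  have hterm (i : ℕ) : f.1 (x n i) = w (n, i) := hfU (n, i) _ (hx n i)
  have hmem : col n ∈ Finset.range (n + 1) := Finset.mem_range_succ_iff.2 (hcol n).1
  simp only [blockAverage_apply, hterm]
  rw [Finset.sum_eq_single_of_mem (col n) hmem fun i _ hi => by simp [w, hi]]
  simp [w]

theorem isOpenQuotientMap_blockAverage {U : ℕ → ℕ → Set X} (hU : ∀ n i, IsOpen (U n i))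
    (hdisj : Pairwise (Disjoint on uncurry U)) {x : ℕ → ℕ → X} (hx : ∀ n i, x n i ∈ U n i) :
    IsOpenQuotientMap (blockAverage x) := by
  have hcol {F : Set X} (hF : F.Finite) : ∃ j, Disjoint F (closure (⋃ n, U n j)) := by
    refine exists_disjoint_of_finite (fun i j hij => ?_) hF
    refine ExtremallyDisconnected.disjoint_closure_of_disjoint_isOpen ?_
      (isOpen_iUnion fun n => hU n i) (isOpen_iUnion fun n => hU n j)
    simp only [disjoint_iUnion_left, disjoint_iUnion_right]
    exact fun m n => hdisj (i := (n, i)) (j := (m, j)) fun h => hij (congrArg Prod.snd h)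
  have hsurj : Surjective (blockAverage x) := fun y =>
    (exists_blockAverage_eq hU hdisj hx 0 le_rfl (by simp)).imp
      fun _ hf => hf.1
  refine ⟨hsurj, (blockAverage x).continuous, IsTopologicalAddGroup.isOpenMap_iff_nhds_zero.2 ?_⟩
  intro s hs
  obtain ⟨⟨F, ε⟩, ⟨hF, hε⟩, hFs⟩ := hasBasis_nhds_zero.mem_iff.1 hs
  obtain ⟨j, hj⟩ := hcol hF
  have hnhds : ∀ᶠ y : ellInfty in 𝓝 0, ∀ n ∈ Iio j, |y.1 n| ≤ ε := by
    refine (eventually_all_finite (finite_Iio j)).2 fun n _ => ?_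
    have hcont : Continuous fun y : ellInfty => |y.1 n| :=
      ((continuous_apply n).comp continuous_subtype_val).abs
    exact hcont.continuousAt.eventually_le_const (by simpa using hε)
  filter_upwards [hnhds] with y hy
  obtain ⟨f, rfl, hf⟩ := exists_blockAverage_eq hU hdisj hx j hε.le hy
  exact hFs fun z hz => hf z (disjoint_left.1 hj hz)

end BlockAverage

section Infinite

variable (X : Type*) [TopologicalSpace X] [T2Space X] [ExtremallyDisconnected X] [Infinite X]

theorem exists_continuousMap_enat_forall_mem_range :
    ∃ q : C(X, ℕ∞), ∀ n : ℕ, ∃ x, q x = n := by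
  obtain ⟨U, hUinf, hU, hdisj⟩ := exists_seq_infinite_isOpen_pairwise_disjoint X
  obtain ⟨q, hq⟩ := exists_continuousMap_enat (V := fun n => closure (U n))
    (fun n => ⟨isClosed_closure, ExtremallyDisconnected.open_closure _ (hU n)⟩)
    fun m n hmn => ExtremallyDisconnected.disjoint_closure_of_disjoint_isOpen (hdisj hmn) (hU m)
      (hU n)
  exact ⟨q, fun n => (hUinf n).nonempty.imp fun x hx => hq n x (subset_closure hx)⟩

theorem exists_isOpenQuotientMap_ellInfty [CompactSpace X] :
    ∃ T : Cp X →L[ℝ] ellInfty, IsOpenQuotientMap T := by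
  obtain ⟨U, hUinf, hU, hdisj⟩ := exists_seq_infinite_isOpen_pairwise_disjoint X
  choose x hx using fun n => (hUinf n).nonempty
  refine ⟨blockAverage fun n i => x (Nat.pair n i), isOpenQuotientMap_blockAverage
    (U := fun n i => U (Nat.pair n i)) (fun n i => hU _) ?_ fun n i => hx _⟩
  exact hdisj.comp_of_injective Nat.pairEquiv.injective

end Infinite

end Cp

theorem corollary2p4_general (X : Type*) [TopologicalSpace X] [CompactSpace X] [T2Space X]
    [ExtremallyDisconnected X] [Infinite X] :
    (∃ Z : Submodule ℝ (Cp X), IsClosed (Z : Set (Cp X)) ∧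
      Nonempty ((Cp X ⧸ Z) ≃L[ℝ] ellInfty)) ∧
    (∃ S : Submodule ℝ (Cp X), Nonempty (S ≃L[ℝ] cZero)) ∧
    (¬ ∃ Z : Submodule ℝ (Cp X), IsClosed (Z : Set (Cp X)) ∧
      Nonempty ((Cp X ⧸ Z) ≃L[ℝ] cZero)) ∧
    (¬ ∃ Z : Submodule ℝ (Cp X), IsClosed (Z : Set (Cp X)) ∧
      ¬ FiniteDimensional ℝ (Cp X ⧸ Z) ∧ IsPolishable (Cp X ⧸ Z)) ∧
    (¬ ∃ S : Submodule ℝ (Cp X), S.ClosedComplemented ∧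
      TopologicalSpace.SeparableSpace S ∧ ¬ FiniteDimensional ℝ S) := by
  refine ⟨?_, ?_, ?_, ?_, ?_⟩
  · obtain ⟨T, hT⟩ := Cp.exists_isOpenQuotientMap_ellInfty X
    exact ⟨T.ker, T.isClosed_ker, nonempty_quotient_ker_equiv hT⟩
  · obtain ⟨q, hq⟩ := Cp.exists_continuousMap_enat_forall_mem_range X
    exact Cp.exists_submodule_equiv_cZero hq
  · rintro ⟨Z, hZ, ⟨e⟩⟩
    obtain ⟨T, hT⟩ := cZero.exists_surjective_continuousMap
    have := Cp.finiteDimensional_quotient_of_surjective hZ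
      (S := (e.symm : cZero →L[ℝ] Cp X ⧸ Z).comp T) (e.symm.surjective.comp hT)
    exact cZero.not_finiteDimensional e.toLinearEquiv.finiteDimensional
  · rintro ⟨Z, hZ, hfin, hpol⟩
    exact hfin (Cp.finiteDimensional_quotient_of_isPolishable hZ hpol)
  · rintro ⟨S, hS, hsep, hfin⟩
    exact hfin (Cp.finiteDimensional_of_closedComplemented hS)

theorem corollary2p4 :
    -- a quotient isomorphic to the space of bounded sequences
    (∃ Z : Submodule ℝ (Cp (StoneCech ℕ)), IsClosed (Z : Set (Cp (StoneCech ℕ))) ∧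
      Nonempty ((Cp (StoneCech ℕ) ⧸ Z) ≃L[ℝ] ellInfty)) ∧
    -- a subspace isomorphic to the space of null sequences
    (∃ S : Submodule ℝ (Cp (StoneCech ℕ)), Nonempty (S ≃L[ℝ] cZero)) ∧
    -- no quotient isomorphic to the space of null sequences
    (¬ ∃ Z : Submodule ℝ (Cp (StoneCech ℕ)), IsClosed (Z : Set (Cp (StoneCech ℕ))) ∧
      Nonempty ((Cp (StoneCech ℕ) ⧸ Z) ≃L[ℝ] cZero)) ∧
    -- no infinite-dimensional Polishable quotient
    (¬ ∃ Z : Submodule ℝ (Cp (StoneCech ℕ)), IsClosed (Z : Set (Cp (StoneCech ℕ))) ∧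
      ¬ FiniteDimensional ℝ (Cp (StoneCech ℕ) ⧸ Z) ∧ IsPolishable (Cp (StoneCech ℕ) ⧸ Z)) ∧
    -- no complemented separable infinite-dimensional subspace
    (¬ ∃ S : Submodule ℝ (Cp (StoneCech ℕ)), S.ClosedComplemented ∧
      TopologicalSpace.SeparableSpace S ∧ ¬ FiniteDimensional ℝ S) := by
  have := CompactT2.Projective.extremallyDisconnected (StoneCech.projective (X := ℕ))
  have : Infinite (StoneCech ℕ) := .of_injective stoneCechUnit injective_stoneCechUnit_of_t35Space
  exact corollary2p4_general (StoneCech ℕ)
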